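/- Let $S$ be a cancellative topological monoid, i.e. a cancellative monoid with a topology (no separation axiom is assumed) for which the multiplication $S\times S\to S$ is continuous. Suppose that $S$ has open shifts, i.e. for every $a\in S$ the maps $x\mapsto ax$ and $x\mapsto xa$ from $S$ to $S$ are open. If $S$ is $\sigma$-compact (a countable union of compact subsets) and sequentially compact (every sequence in $S$ has a subsequence converging in $S$), then $S$ has countable cellularity, i.e. $c(S)=\aleph_0$, where $$c(S)=\sup\{|\mathcal U| : \mathcal U \text{ is a nonempty family of nonempty pairwise disjoint open subsets of } S\}+\aleph_0 .$$ -/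

import Mathlib

/-- A semigroup with a topology has *open shifts* if all left shifts `x ↦ a * x` and all right
shifts `x ↦ x * a` are open maps. -/
def HasOpenShifts (S : Type*) [Mul S] [TopologicalSpace S] : Prop :=
  ∀ a : S, IsOpenMap (fun x : S => a * x) ∧ IsOpenMap (fun x : S => x * a)

/-- A *cellular family* in `X`: a nonempty family of nonempty, pairwise disjoint open sets. -/
structure IsCellularFamily {X : Type*} [TopologicalSpace X] (𝒰 : Set (Set X)) : Prop where
  nonempty : 𝒰.Nonempty
  isOpen_of_mem : ∀ U ∈ 𝒰, IsOpen U
  nonempty_of_mem : ∀ U ∈ 𝒰, U.Nonempty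
  pairwiseDisjoint : 𝒰.PairwiseDisjoint id

/-- The *cellularity* of `X`: the supremum of the cardinalities of the cellular families in `X`,
plus `ℵ₀`. The supremum is over a family indexed by a type in the same universe as `X`, hence
is a genuine (bounded) supremum of cardinals. -/
noncomputable def cellularity (X : Type*) [TopologicalSpace X] : Cardinal :=
  (⨆ 𝒰 : {𝒰 : Set (Set X) // IsCellularFamily 𝒰}, Cardinal.mk 𝒰.1) + Cardinal.aleph0

/-- `X` has *countable cellularity* (the Souslin property) if its cellularity is `ℵ₀`. -/
def HasCountableCellularity (X : Type*) [TopologicalSpace X] : Prop :=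
  cellularity X = Cardinal.aleph0

/-!
The idea is that, as far as intersections of open sets are concerned, the monoid behaves like a
totally bounded topological group; sequential compactness alone is responsible for this.

* *Approximate inverses* (`exists_nhds_one_approx_right_inv`): every neighbourhood `V` of `1`
  contains approximate inverses of all elements `u` of some smaller neighbourhood `W`, that is,
  `u * V` meets every neighbourhood of `1`. Otherwise take counterexamples `v n` tending to `1` so
  fast that all products `v (n + 1) * ⋯ * v m` lie in `V`. A subsequence of the partial products
  `v 0 * ⋯ * v n` converges to some `z`, so it has the form `z * u k` with `u k → 1`. Then
  `u l = u k * v n * s` with `s` a product of later terms, and `u l * u k` is close to `u k` for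
  large `l`; cancelling `u k` shows that `v n * (s * u k)` is close to `1`.
* *Total boundedness* (`exists_finset_forall_translates_meet`): for a neighbourhood `W` of `1`,
  there is no infinite family of pairwise disjoint translates `W * x`.

Given disjoint open sets `U i` around points `x i`, shrink each of them to suitable neighbourhoods
of `1`, and build an increasing sequence of finite index sets `M n` such that every `x i` is
`M n`-close, in the sense of total boundedness, to some `x j` with `j ∈ M (n + 1)`. If an index `a`
lay outside the union of the `M n`, one would get `b n ∈ M (n + 1)` with `x (b n)` close to `x a`
for all neighbourhoods attached to `M n`, and a subsequence of `x (b n)` converges. Choosing `c`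
and then `b` far out in it, the "element" `x a * (x b)⁻¹ * x c` is close to `x a` because `x b` and
`x c` are close to each other, and close to `x c` because `x a` and `x b` are. Approximate inverses
make sense of this expression, and `U a` meets `U c`. So the union of the `M n` contains all
indices, and there are countably many.
-/

open Filter Topology

/-! ### Neighbourhoods under open shifts -/

theorem HasOpenShifts.image_mul_left_mem_nhds {S : Type*} [Monoid S] [TopologicalSpace S]
    (hshift : HasOpenShifts S) (a : S) {V : Set S} (hV : V ∈ 𝓝 (1 : S)) :
    (fun x => a * x) '' V ∈ 𝓝 a := by
  simpa using (hshift a).1.image_mem_nhds hV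

theorem HasOpenShifts.image_mul_right_mem_nhds {S : Type*} [Monoid S] [TopologicalSpace S]
    (hshift : HasOpenShifts S) (a : S) {V : Set S} (hV : V ∈ 𝓝 (1 : S)) :
    (fun x => x * a) '' V ∈ 𝓝 a := by
  simpa using (hshift a).2.image_mem_nhds hV

theorem HasOpenShifts.mulOpposite {S : Type*} [Mul S] [TopologicalSpace S]
    (hshift : HasOpenShifts S) : HasOpenShifts Sᵐᵒᵖ := fun a =>
  ⟨MulOpposite.opHomeomorph.isOpenMap.comp
      ((hshift a.unop).2.comp MulOpposite.opHomeomorph.symm.isOpenMap),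
    MulOpposite.opHomeomorph.isOpenMap.comp
      ((hshift a.unop).1.comp MulOpposite.opHomeomorph.symm.isOpenMap)⟩

theorem MulOpposite.seqCompactSpace {S : Type*} [TopologicalSpace S] [SeqCompactSpace S] :
    SeqCompactSpace Sᵐᵒᵖ := by
  refine ⟨fun x _ => ?_⟩
  obtain ⟨a, φ, hφ, ha⟩ := SeqCompactSpace.tendsto_subseq fun n => (x n).unop
  exact ⟨MulOpposite.op a, Set.mem_univ _, φ, hφ,
    (MulOpposite.continuous_op.tendsto a).comp ha⟩

/-! ### Products of consecutive terms of a sequence -/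

/-- The product `v n * v (n + 1) * ⋯ * v (n + d - 1)` of `d` consecutive terms of `v`. -/
def consecutiveProd {S : Type*} [Monoid S] (v : ℕ → S) : ℕ → ℕ → S
  | _, 0 => 1
  | n, d + 1 => v n * consecutiveProd v (n + 1) d

theorem consecutiveProd_add {S : Type*} [Monoid S] (v : ℕ → S) (n d e : ℕ) :
    consecutiveProd v n (d + e) = consecutiveProd v n d * consecutiveProd v (n + d) e := by
  induction d generalizing n with
  | zero => simp [consecutiveProd]
  | succ d ih =>
    rw [Nat.add_right_comm, consecutiveProd, ih, consecutiveProd, mul_assoc,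
      Nat.add_right_comm n 1 d, Nat.add_assoc n d 1]

theorem consecutiveProd_mem {S : Type*} [Monoid S] {v : ℕ → S} {W : ℕ → Set S}
    (h1 : ∀ n, (1 : S) ∈ W n) (hW : ∀ n, ∀ a ∈ W (n + 1), ∀ b ∈ W (n + 1), a * b ∈ W n)
    (hv : ∀ n, v n ∈ W (n + 1)) (n d : ℕ) : consecutiveProd v n d ∈ W n := by
  induction d generalizing n with
  | zero => exact h1 n
  | succ d ih => exact hW n _ (hv n) _ (ih (n + 1))

/-! ### Approximate inverses -/

theorem exists_nhds_one_mul_mem {S : Type*} [Monoid S] [TopologicalSpace S] [ContinuousMul S]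
    {V : Set S} (hV : V ∈ 𝓝 (1 : S)) :
    ∃ W ∈ 𝓝 (1 : S), ∀ a ∈ W, ∀ b ∈ W, a * b ∈ V := by
  obtain ⟨W, hWo, hW1, hW⟩ := exists_open_nhds_one_split hV
  exact ⟨W, hWo.mem_nhds hW1, hW⟩

theorem exists_nhds_one_approx_right_inv {S : Type*} [CancelMonoid S] [TopologicalSpace S]
    [ContinuousMul S] [SeqCompactSpace S] (hshift : HasOpenShifts S) {V : Set S}
    (hV : V ∈ 𝓝 (1 : S)) :
    ∃ W ∈ 𝓝 (1 : S), ∀ u ∈ W, ∀ T ∈ 𝓝 (1 : S), ∃ p ∈ V, u * p ∈ T := by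
  by_contra! hbad
  obtain ⟨V', hV', hV'V⟩ := exists_nhds_one_mul_mem hV
  choose half hhalf hhalf_mul using
    fun A : {A : Set S // A ∈ 𝓝 (1 : S)} => exists_nhds_one_mul_mem A.2
  let W : ℕ → {A : Set S // A ∈ 𝓝 (1 : S)} :=
    fun n => Nat.rec ⟨V', hV'⟩ (fun _ A => ⟨half A, hhalf A⟩) n
  have hWmul (n : ℕ) : ∀ a ∈ (W (n + 1)).1, ∀ b ∈ (W (n + 1)).1, a * b ∈ (W n).1 :=
    hhalf_mul (W n)
  have hWone (n : ℕ) : (1 : S) ∈ (W n).1 := mem_of_mem_nhds (W n).2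
  have hWsub (n : ℕ) : (W n).1 ⊆ V' := by
    induction n with
    | zero => exact subset_rfl
    | succ n ih => exact fun a ha => ih (by simpa using hWmul n a ha 1 (hWone (n + 1)))
  choose v hv T hT hvT using fun n => hbad (W (n + 1)).1 (W (n + 1)).2
  obtain ⟨z, φ, hφ, hz⟩ := SeqCompactSpace.tendsto_subseq (consecutiveProd v 0)
  obtain ⟨k, u, huV, hu⟩ := (hz.eventually (hshift.image_mul_left_mem_nhds z hV')).exists
  -- `u * T` is a neighbourhood of `u`, so `u' * u` lies in it for every `u'` close to `1`.
  have hnear : {u' : S | u' * u ∈ (fun x => u * x) '' T (φ k)} ∈ 𝓝 (1 : S) := by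
    have hc : Tendsto (fun u' : S => u' * u) (𝓝 1) (𝓝 u) := by
      simpa using ((continuous_mul_const u).tendsto (1 : S))
    exact hc (hshift.image_mul_left_mem_nhds u (hT (φ k)))
  obtain ⟨l, ⟨u', ⟨t, htT, htu⟩, hu'⟩, hkl⟩ :=
    ((hz.eventually (hshift.image_mul_left_mem_nhds z hnear)).and
      (eventually_gt_atTop k)).exists
  obtain ⟨d, hd⟩ := Nat.exists_eq_add_of_lt (hφ hkl)
  let s := consecutiveProd v (φ k + 1) d
  have hs : s ∈ V' := hWsub _ (consecutiveProd_mem hWone hWmul hv _ _)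
  have hu's : u' = u * (v (φ k) * s) := by
    have h : consecutiveProd v 0 (φ l) = consecutiveProd v 0 (φ k) * (v (φ k) * s) := by
      rw [hd, add_assoc, consecutiveProd_add, zero_add]
      rfl
    have hl : z * u' = consecutiveProd v 0 (φ l) := hu'
    have hk : z * u = consecutiveProd v 0 (φ k) := hu
    refine mul_left_cancel (a := z) ?_
    rw [hl, h, ← hk, mul_assoc]
  have ht : v (φ k) * (s * u) = t := by
    refine mul_left_cancel (a := u) ?_
    simpa [hu's, mul_assoc] using htu.symm
  exact hvT (φ k) _ (hV'V s hs u huV) (ht ▸ htT)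

theorem exists_nhds_one_approx_left_inv {S : Type*} [CancelMonoid S] [TopologicalSpace S]
    [ContinuousMul S] [SeqCompactSpace S] (hshift : HasOpenShifts S) {V : Set S}
    (hV : V ∈ 𝓝 (1 : S)) :
    ∃ W ∈ 𝓝 (1 : S), ∀ u ∈ W, ∀ T ∈ 𝓝 (1 : S), ∃ p ∈ V, p * u ∈ T := by
  have := MulOpposite.seqCompactSpace (S := S)
  obtain ⟨W, hW, h⟩ := exists_nhds_one_approx_right_inv hshift.mulOpposite
    (V := MulOpposite.unop ⁻¹' V) (MulOpposite.continuous_unop.continuousAt hV)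
  refine ⟨MulOpposite.op ⁻¹' W, MulOpposite.continuous_op.continuousAt hW, fun u hu T hT => ?_⟩
  obtain ⟨p, hp, hpT⟩ := h _ hu (MulOpposite.unop ⁻¹' T)
    (MulOpposite.continuous_unop.continuousAt hT)
  exact ⟨p.unop, hp, hpT⟩

/-! ### Total boundedness -/

/-- For a neighbourhood `W` of `1`, the translates `W * x n` of a sequence are not pairwise
disjoint: if `x n = v n * y` with `v n → 1`, then `v m * v n ∈ W * v m` for large `n`, so that
`v m * x n` lies in both `W * x n` and `W * x m`. -/
theorem exists_lt_translates_meet {S : Type*} [CancelMonoid S] [TopologicalSpace S]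
    [ContinuousMul S] [SeqCompactSpace S] (hshift : HasOpenShifts S) {W : Set S}
    (hW : W ∈ 𝓝 (1 : S)) (x : ℕ → S) :
    ∃ m n, m < n ∧ ∃ w ∈ W, ∃ w' ∈ W, w * x m = w' * x n := by
  obtain ⟨y, φ, hφ, hy⟩ := SeqCompactSpace.tendsto_subseq x
  obtain ⟨m, v, hvW, hv⟩ := (hy.eventually (hshift.image_mul_right_mem_nhds y hW)).exists
  have hnear : {v' : S | v * v' ∈ (fun a => a * v) '' W} ∈ 𝓝 (1 : S) := by
    have hc : Tendsto (fun v' : S => v * v') (𝓝 1) (𝓝 v) := by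
      simpa using ((continuous_const_mul v).tendsto (1 : S))
    exact hc (hshift.image_mul_right_mem_nhds v hW)
  obtain ⟨n, ⟨v', ⟨w, hwW, hw⟩, hv'⟩, hmn⟩ :=
    ((hy.eventually (hshift.image_mul_right_mem_nhds y hnear)).and
      (eventually_gt_atTop m)).exists
  refine ⟨φ m, φ n, hφ hmn, w, hwW, v, hvW, ?_⟩
  have hv₁ : x (φ m) = v * y := hv.symm
  have hv₂ : x (φ n) = v' * y := hv'.symm
  have hw' : w * v = v * v' := hw
  rw [hv₁, hv₂, ← mul_assoc, hw', mul_assoc]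

theorem exists_finset_forall_translates_meet {S I : Type*} [CancelMonoid S] [TopologicalSpace S]
    [ContinuousMul S] [SeqCompactSpace S] (hshift : HasOpenShifts S) {W : Set S}
    (hW : W ∈ 𝓝 (1 : S)) (x : I → S) :
    ∃ F : Finset I, ∀ i, ∃ j ∈ F, ∃ w ∈ W, ∃ w' ∈ W, w * x i = w' * x j := by
  by_contra! hbad
  obtain ⟨f, -, hf⟩ := exists_seq_of_forall_finset_exists (fun _ : I => True)
    (fun j i => ∀ w ∈ W, ∀ w' ∈ W, w * x i ≠ w' * x j)
    fun F _ => (hbad F).imp fun i hi => ⟨trivial, hi⟩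
  obtain ⟨m, n, hmn, w, hw, w', hw', h⟩ := exists_lt_translates_meet hshift hW (x ∘ f)
  exact hf m n hmn w' hw' w hw h.symm

/-! ### Countable cellularity -/

/-- The data attached to each member `U` of a disjoint family: the elements `a * p * v` and
`q * w' * o` of `U` stand for `a * u⁻¹ * v` and `w⁻¹ * w' * o`, where `p` and `q` in `A` are
approximate inverses of `u` and `w` in `B`. -/
theorem exists_nhds_approx_inv_of_isOpen {S : Type*} [CancelMonoid S] [TopologicalSpace S]
    [ContinuousMul S] [SeqCompactSpace S] (hshift : HasOpenShifts S) {U : Set S} (hU : IsOpen U)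
    {a : S} (ha : a ∈ U) :
    ∃ A : Set S, ∃ B ∈ 𝓝 (1 : S), ∃ O ∈ 𝓝 a,
      (∀ p ∈ A, ∀ q ∈ B, ∀ o ∈ O, p * (q * o) ∈ U) ∧
      (∀ p ∈ A, ∀ q ∈ B, a * (p * q) ∈ U) ∧
      (∀ u ∈ B, ∀ T ∈ 𝓝 (1 : S), ∃ p ∈ A, u * p ∈ T) ∧
      (∀ u ∈ B, ∀ T ∈ 𝓝 (1 : S), ∃ p ∈ A, p * u ∈ T) := by
  have h₁ : Tendsto (fun r : S × S × S => r.1 * (r.2.1 * r.2.2)) (𝓝 1 ×ˢ 𝓝 1 ×ˢ 𝓝 a) (𝓝 a) := by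
    have hc : Continuous fun r : S × S × S => r.1 * (r.2.1 * r.2.2) := by fun_prop
    simpa [nhds_prod_eq] using hc.tendsto ((1 : S), (1 : S), a)
  have h₂ : Tendsto (fun r : S × S => a * (r.1 * r.2)) (𝓝 1 ×ˢ 𝓝 1) (𝓝 a) := by
    have hc : Continuous fun r : S × S => a * (r.1 * r.2) := by fun_prop
    simpa [nhds_prod_eq] using hc.tendsto ((1 : S), (1 : S))
  obtain ⟨A₁, hA₁, R, hR, hA₁R⟩ := mem_prod_iff.1 (h₁ (hU.mem_nhds ha))
  obtain ⟨B₁, hB₁, O, hO, hB₁O⟩ := mem_prod_iff.1 hR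
  obtain ⟨A₂, hA₂, B₂, hB₂, hA₂B₂⟩ := mem_prod_iff.1 (h₂ (hU.mem_nhds ha))
  have hA := inter_mem hA₁ hA₂
  obtain ⟨C, hC, hCinv⟩ := exists_nhds_one_approx_right_inv hshift hA
  obtain ⟨D, hD, hDinv⟩ := exists_nhds_one_approx_left_inv hshift hA
  refine ⟨A₁ ∩ A₂, (B₁ ∩ B₂) ∩ (C ∩ D), inter_mem (inter_mem hB₁ hB₂) (inter_mem hC hD), O, hO,
    fun p hp q hq o ho => hA₁R (Set.mk_mem_prod hp.1 (hB₁O (Set.mk_mem_prod hq.1.1 ho))),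
    fun p hp q hq => hA₂B₂ (Set.mk_mem_prod hp.2 hq.1.2),
    fun u hu => hCinv u hu.2.1, fun u hu => hDinv u hu.2.2⟩

theorem countable_of_pairwise_disjoint_isOpen {S I : Type*} [CancelMonoid S]
    [TopologicalSpace S] [ContinuousMul S] [SeqCompactSpace S] (hshift : HasOpenShifts S)
    {U : I → Set S} (hU : ∀ i, IsOpen (U i)) (hne : ∀ i, (U i).Nonempty)
    (hdisj : Pairwise fun i j => Disjoint (U i) (U j)) : Countable I := by
  classical
  choose x hx using hne
  choose A B hB O hO hABO hAB hright hleft using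
    fun i => exists_nhds_approx_inv_of_isOpen hshift (hU i) (hx i)
  choose G hG using fun F : Finset I => exists_finset_forall_translates_meet hshift
    ((biInter_finset_mem F).2 fun i _ => hB i) x
  let M : ℕ → Finset I := fun n => Nat.rec ∅ (fun _ F => F ∪ G F) n
  have hMsucc (n : ℕ) : M (n + 1) = M n ∪ G (M n) := rfl
  have hMmono : Monotone M :=
    monotone_nat_of_le_succ fun n => by rw [hMsucc]; exact Finset.subset_union_left
  have hMcount : Set.Countable {a | ∃ n, a ∈ M n} := by
    rw [Set.ofPred_exists]
    exact Set.countable_iUnion fun n => (M n).countable_toSet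
  suffices hall : ∀ a, ∃ n, a ∈ M n from
    Set.countable_univ_iff.1 (hMcount.mono fun a _ => hall a)
  intro a
  by_contra ha
  choose b hb w hw w' hw' hww' using fun n => hG (M n) a
  have hbM (n : ℕ) : b n ∈ M (n + 1) := by
    rw [hMsucc]
    exact Finset.mem_union_right _ (hb n)
  obtain ⟨y, φ, hφ, hy⟩ := SeqCompactSpace.tendsto_subseq fun n => x (b n)
  obtain ⟨N, hN⟩ :=
    eventually_atTop.1 (hy.eventually (hshift.image_mul_left_mem_nhds y (hB a)))
  -- The second index `j` is so large that `b (φ N)` belongs to `M j`.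
  obtain ⟨j, hNj, u, huB, hu⟩ : ∃ j, φ N + 1 ≤ j ∧ ∃ u ∈ B a, y * u = x (b j) :=
    ⟨φ (max N (φ N + 1)), (le_max_right _ _).trans (hφ.id_le _), hN _ (le_max_left _ _)⟩
  obtain ⟨v, hvB, hv⟩ : ∃ v ∈ B a, y * v = x (b (φ N)) := hN N le_rfl
  set c := b (φ N)
  have hcM : c ∈ M j := hMmono hNj (hbM (φ N))
  have hac : a ≠ c := fun h => ha ⟨j, h ▸ hcM⟩
  have hwB : w j ∈ B c := Set.mem_iInter₂.1 (hw j) c hcM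
  have hwB' : w' j ∈ B c := Set.mem_iInter₂.1 (hw' j) c hcM
  -- `p` approximates `u⁻¹`, and `q` below approximates `(w j)⁻¹`.
  obtain ⟨p, hpA, hp⟩ := hright a u huB {t | y * t * v ∈ O c} <| by
    have hc : Continuous fun t : S => y * t * v := by fun_prop
    refine hc.continuousAt ?_
    simpa [hv] using hO c
  have hpU : x a * (p * v) ∈ U a := hAB a p hpA v hvB
  obtain ⟨q, hqA, hq⟩ := hleft c (w j) hwB {t | t * (x a * (p * v)) ∈ U a} <| by
    refine (continuous_mul_const (x a * (p * v))).continuousAt ?_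
    simpa using (hU a).mem_nhds hpU
  have hqU : q * (w' j * (y * (u * p) * v)) ∈ U c := hABO c q hqA _ hwB' _ hp
  have heq : q * w j * (x a * (p * v)) = q * (w' j * (y * (u * p) * v)) := by
    have h : w j * x a = w' j * (y * u) := by rw [hu]; exact hww' j
    calc q * w j * (x a * (p * v)) = q * (w j * x a) * (p * v) := by simp only [mul_assoc]
      _ = q * (w' j * (y * (u * p) * v)) := by rw [h]; simp only [mul_assoc]
  exact Set.disjoint_left.1 (hdisj hac) hq (heq ▸ hqU)

theorem mainTheorem2 {S : Type*} [CancelMonoid S] [TopologicalSpace S] [ContinuousMul S]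
    (hshift : HasOpenShifts S) [SigmaCompactSpace S] [SeqCompactSpace S] :
    HasCountableCellularity S := by
  refine le_antisymm (Cardinal.add_le_aleph0.2 ⟨ciSup_le' fun 𝒰 => ?_, le_rfl⟩)
    (self_le_add_left _ _)
  have : Countable 𝒰.1 := countable_of_pairwise_disjoint_isOpen (U := fun V : 𝒰.1 => V.1) hshift
    (fun V => 𝒰.2.isOpen_of_mem V V.2) (fun V => 𝒰.2.nonempty_of_mem V V.2)
    fun V V' h => 𝒰.2.pairwiseDisjoint V.2 V'.2 fun h' => h (Subtype.ext h')
  exact Cardinal.mk_le_aleph0
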